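/- Let $X$ be a topological space and let $U,V\subset X$ be path-connected open subsets with $X=U\cup V$ such that the intersection $U\cap V$ has exactly two path components $A$ and $B$, where $B$ is open in $X$ (as is automatic when $X$ is locally path-connected). Let $a\in A$, $b\in B$. Let $C$ be the quotient space of the disjoint union $U'\sqcup V$, where $U'$ is a copy of $U$, by the identification of every point of $B\subset V$ with the corresponding point of the copy $B'\subset U'$ of $B$; write $b\in C$ also for the image of $b$, and let $\sigma\colon C\to X$ be the map given by the inclusion on $V$ and by the tautological map $U'\to U\subset X$ on $U'$. Write $r\cdot s$ for the path that runs first along $r$ and then along $s$, let products in fundamental groups be induced by it, and for a path $r$ from $x$ to $y$ in a space $Z$ let $\pi(r)\colon\pi_1(Z,y)\to\pi_1(Z,x)$ be the isomorphism $[s]\mapsto[r\cdot s\cdot r^{-1}]$. Let $p$ be a path from $b$ to $a$ in $U$ and $q$ a path from $b$ to $a$ in $V$; let $p'$ be the copy of $p$ in $U'$, and regard $p'$ and $q$ also as paths in $C$. Let $i\colon A\to C$ be the inclusion through $V$ and $\widehat{\imath}\colon A\to C$ the composition of the tautological homeomorphism of $A$ with its copy $A'\subset U'$ and the inclusion $A'\to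 C$. Put \[ \theta=\pi(q)\circ i_*\,,\qquad \widehat{\theta}=\pi(p')\circ\widehat{\imath}_*\ \colon\ \pi_1(A,a)\longrightarrow\pi_1(C,b), \] and let $\tau\in\pi_1(X,b)$ be the class of the loop $p\cdot q^{-1}$. Let $F$ be the free group with one generator $t$. Then $\pi_1(X,b)$ is isomorphic to the quotient of the free product $\pi_1(C,b)*F$ by the relations \[ \widehat{\theta}(\alpha)=t\,\theta(\alpha)\,t^{-1}\qquad\text{for all }\alpha\in\pi_1(A,a), \] by an isomorphism for which the corresponding homomorphism $\pi_1(C,b)*F\to\pi_1(X,b)$ is equal to $\sigma_*$ on $\pi_1(C,b)$ and maps $t$ to $\tau$. -/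

import Mathlib

namespace VanKampen

open MulOpposite

universe u v

noncomputable section

/-- The fundamental group `π₁(X, x)` in the convention in which the product `[γ] * [δ]` is the class
of the path that runs first along `γ` and then along `δ` (see `ofLoop_mul`). Mathlib's
`FundamentalGroup` multiplies in the opposite order, whence the opposite group. -/
abbrev PiOne (X : Type u) [TopologicalSpace X] (x : X) : Type u :=
  (FundamentalGroup X x)ᵐᵒᵖ

namespace PiOne

variable {X : Type u} [TopologicalSpace X] {Y : Type v} [TopologicalSpace Y]

/-- The homotopy class of a loop. -/
def ofLoop {x : X} (γ : Path x x) : PiOne X x :=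
  op (FundamentalGroup.fromPath (Path.Homotopic.Quotient.mk γ))

/-- The homomorphism induced by a continuous map `f` with `f x = y`. -/
def map (f : C(X, Y)) {x : X} {y : Y} (h : f x = y) : PiOne X x →* PiOne Y y :=
  MonoidHom.op (FundamentalGroup.mapOfEq f h)

/-- Change of the base point along a path `p` from `b` to `a`: the map `[r] ↦ [p · r · p⁻¹]`
(see `changeBase_ofLoop`). -/
def changeBase {b a : X} (p : Path b a) : PiOne X a →* PiOne X b :=
  MonoidHom.op (FundamentalGroup.fundamentalGroupMulEquivOfPath p.symm).toMonoidHom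

theorem ofLoop_mul {x : X} (γ δ : Path x x) : ofLoop γ * ofLoop δ = ofLoop (γ.trans δ) := rfl

theorem map_ofLoop (f : C(X, Y)) {x : X} {y : Y} (h : f x = y) (γ : Path x x) :
    map f h (ofLoop γ) = ofLoop ((γ.map f.continuous).cast h.symm h.symm) := by
  subst h
  exact congrArg op (FundamentalGroup.mapOfEq_apply f rfl _)

theorem changeBase_ofLoop {b a : X} (p : Path b a) (r : Path a a) :
    changeBase p (ofLoop r) = ofLoop (p.trans (r.trans p.symm)) := by
  have h : changeBase p (ofLoop r) = ofLoop (p.symm.symm.trans (r.trans p.symm)) := rfl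
  rwa [Path.symm_symm] at h

end PiOne

theorem left_subset_U {X : Type u} {U V A B : Set X} (hUV : U ∩ V = A ∪ B) : A ⊆ U :=
  fun _ hx => (hUV.symm.subset (Or.inl hx)).1

theorem left_subset_V {X : Type u} {U V A B : Set X} (hUV : U ∩ V = A ∪ B) : A ⊆ V :=
  fun _ hx => (hUV.symm.subset (Or.inl hx)).2

theorem right_subset_U {X : Type u} {U V A B : Set X} (hUV : U ∩ V = A ∪ B) : B ⊆ U :=
  fun _ hx => (hUV.symm.subset (Or.inr hx)).1

theorem right_subset_V {X : Type u} {U V A B : Set X} (hUV : U ∩ V = A ∪ B) : B ⊆ V :=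
  fun _ hx => (hUV.symm.subset (Or.inr hx)).2

variable {X : Type u} [TopologicalSpace X]

/-- The underlying point in `X` of a point of the disjoint union of `U` and `V`. -/
def underlying (U V : Set X) : U ⊕ V → X := Sum.elim Subtype.val Subtype.val

/-- Two points of the disjoint union of (a copy of) `U` and `V` are identified when they are equal
or when they have the same underlying point and this point lies in `B`. -/
def glueSetoid (U V B : Set X) : Setoid (U ⊕ V) where
  r s t := s = t ∨ (underlying U V s = underlying U V t ∧ underlying U V s ∈ B)
  iseqv :=
    { refl := fun _ => Or.inl rfl
      symm := by
        rintro s t (h | ⟨h, hB⟩)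
        · exact Or.inl h.symm
        · exact Or.inr ⟨h.symm, h ▸ hB⟩
      trans := by
        rintro s t r (rfl | ⟨h, hB⟩) (rfl | ⟨h', hB'⟩)
        · exact Or.inl rfl
        · exact Or.inr ⟨h', hB'⟩
        · exact Or.inr ⟨h, hB⟩
        · exact Or.inr ⟨h.trans h', hB⟩ }

/-- The space `C`: the disjoint union of a copy `U'` of `U` and of `V`, with the copy `B'` of `B`
in `U'` identified with `B` in `V`, with the quotient topology. -/
def Glue (U V B : Set X) : Type u := Quotient (glueSetoid U V B)

instance (U V B : Set X) : TopologicalSpace (Glue U V B) :=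
  inferInstanceAs (TopologicalSpace (Quotient (glueSetoid U V B)))

/-- The canonical map of `U`, identified with its copy `U'`, to `C`. -/
def inU (U V B : Set X) : C(U, Glue U V B) where
  toFun x := Quotient.mk (glueSetoid U V B) (Sum.inl x)
  continuous_toFun := continuous_quotient_mk'.comp continuous_inl

/-- The canonical map of `V` to `C`. -/
def inV (U V B : Set X) : C(V, Glue U V B) where
  toFun x := Quotient.mk (glueSetoid U V B) (Sum.inr x)
  continuous_toFun := continuous_quotient_mk'.comp continuous_inr

/-- The map `σ : C → X` that is the inclusion on `V` and the tautological map on `U'`. -/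
def sigma (U V B : Set X) : C(Glue U V B, X) where
  toFun := Quotient.lift (underlying U V) (by
    rintro s t (rfl | ⟨h, -⟩)
    · rfl
    · exact h)
  continuous_toFun := Continuous.quotient_lift
    (continuous_subtype_val.sumElim continuous_subtype_val) _

theorem inU_eq_inV {U V B : Set X} {x : X} (hU : x ∈ U) (hV : x ∈ V) (hB : x ∈ B) :
    inU U V B ⟨x, hU⟩ = inV U V B ⟨x, hV⟩ :=
  Quotient.sound (Or.inr ⟨rfl, hB⟩)

/-- The homomorphism `θ = π(q) ∘ i_* : π₁(A, a) → π₁(C, b)`, where `i : A → C` is the inclusion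
through `V` and `q` is a path in `V` from `b` to `a`. -/
def theta {U V A B : Set X} (hUV : U ∩ V = A ∪ B) {a b : X} (ha : a ∈ A) (hb : b ∈ B)
    (q : Path (⟨b, right_subset_V hUV hb⟩ : V) ⟨a, left_subset_V hUV ha⟩) :
    PiOne A ⟨a, ha⟩ →* PiOne (Glue U V B) (inV U V B ⟨b, right_subset_V hUV hb⟩) :=
  (PiOne.changeBase (q.map (inV U V B).continuous)).comp
    (PiOne.map ((inV U V B).comp (ContinuousMap.inclusion (left_subset_V hUV))) rfl)

/-- The homomorphism `θ̂ = π(p') ∘ î_* : π₁(A, a) → π₁(C, b)`, where `î : A → C` is the map through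
the copy `U'` of `U` and `p'` is the copy in `U'` of a path `p` in `U` from `b` to `a`. -/
def thetaHat {U V A B : Set X} (hUV : U ∩ V = A ∪ B) {a b : X} (ha : a ∈ A) (hb : b ∈ B)
    (p : Path (⟨b, right_subset_U hUV hb⟩ : U) ⟨a, left_subset_U hUV ha⟩) :
    PiOne A ⟨a, ha⟩ →* PiOne (Glue U V B) (inV U V B ⟨b, right_subset_V hUV hb⟩) :=
  (PiOne.changeBase ((p.map (inU U V B).continuous).cast
      (inU_eq_inV (right_subset_U hUV hb) (right_subset_V hUV hb) hb).symm rfl)).comp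
    (PiOne.map ((inU U V B).comp (ContinuousMap.inclusion (left_subset_U hUV))) rfl)

/-- The class `τ ∈ π₁(X, b)` of the loop `p · q⁻¹`. -/
def tau {U V A B : Set X} (hUV : U ∩ V = A ∪ B) {a b : X} (ha : a ∈ A) (hb : b ∈ B)
    (p : Path (⟨b, right_subset_U hUV hb⟩ : U) ⟨a, left_subset_U hUV ha⟩)
    (q : Path (⟨b, right_subset_V hUV hb⟩ : V) ⟨a, left_subset_V hUV ha⟩) : PiOne X b :=
  PiOne.ofLoop (Path.trans (x := b) (y := a) (z := b)
    (p.map continuous_subtype_val) (q.map continuous_subtype_val).symm)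

/-- The free group `F` with one generator. -/
abbrev F : Type := FreeGroup Unit

/-- The generator `t` of `F`. -/
def t : F := FreeGroup.of ()

/-- For homomorphisms `θ, θ̂ : K → H`, the elements `θ̂(α) (t θ(α) t⁻¹)⁻¹` of `H * F`. -/
def relators {K : Type u} {H : Type v} [Group K] [Group H] (θ θhat : K →* H) :
    Set (Monoid.Coprod H F) :=
  Set.range fun α : K => Monoid.Coprod.inl (θhat α) *
    (Monoid.Coprod.inr t * Monoid.Coprod.inl (θ α) * (Monoid.Coprod.inr t)⁻¹)⁻¹

/-- The group `(H * F) / ⟨θ̂(α) = t θ(α) t⁻¹ for all α⟩`. -/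
abbrev FreeProductWithRelation {K : Type u} {H : Type v} [Group K] [Group H] (θ θhat : K →* H) :
    Type v :=
  Monoid.Coprod H F ⧸ Subgroup.normalClosure (relators θ θhat)

end

end VanKampen

namespace VanKampen

open Topology Filter unitInterval MulOpposite

/-! The relation holds in `π₁(X, b)` because both copies of `A` in `C` have the same image under
`σ`, so `σ_* ∘ θ̂` and `σ_* ∘ θ` differ by conjugation with `τ`. This gives a homomorphism `Φ` from
the quotient `G` to `π₁(X, b)` (`toPiOne`), and the work is to invert it.

The inverse comes from transports: group-valued functions of curves that commute around squares, in
effect functors from the fundamental groupoid to a group. The van Kampen argument takes the form of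
`IsTransport.exists_extension`: a transport that commutes only around squares inside members of an
open cover extends from the small curves to a global transport. Along a curve the extension is
obtained by continuing a primitive over a subdivision, and it commutes around squares because a
suitable product is locally constant in the height. Uniqueness is `IsTransport.eq_of_small`.

On `C` choose classes of paths from `b` to all points, of the form `q · d` and `p' · d` on the two
copies of `A`. They turn `π₁(C, b) → G` into a transport on `C`. Along the two copies of a curve in
`A` its values are the images of `θ̂(α)` and `θ(α)` for one `α`; a gauge equal to `t` on `A'` and to
`1` elsewhere makes them equal, exactly by the relation. The two copies of a curve in `B` coincide
in `C`. Hence the transport descends to `X = U ∪ V` and defines `Ψ : π₁(X, b) → G`. That `Ψ ∘ Φ` is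
the identity is checked on generators; that `Φ ∘ Ψ` is the identity follows by comparing two
transports on `X` on small curves. -/

/-! ### Segments in the unit interval -/

/-- The linear path from `s` to `t` in the unit interval. -/
def seg (s t : I) : C(I, I) := ⟨Set.Icc.convexComb s t, Set.Icc.continuous_convexComb s t⟩

theorem seg_zero (s t : I) : seg s t 0 = s := Set.Icc.convexComb_zero s t

theorem seg_one (s t : I) : seg s t 1 = t := Set.Icc.convexComb_one s t

theorem seg_self (s : I) : seg s s = ContinuousMap.const I s :=
  ContinuousMap.ext fun x => Set.Icc.convexComb_eq s x

theorem seg_zero_one : seg 0 1 = ContinuousMap.id I :=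
  ContinuousMap.ext fun x => Set.Icc.convexComb_zero_one x

theorem seg_mem {J : Set I} [hJ : J.OrdConnected] {s t : I} (hs : s ∈ J) (ht : t ∈ J) (x : I) :
    seg s t x ∈ J := by
  rcases le_total s t with h | h
  · exact hJ.out hs ht ⟨Set.Icc.le_convexComb h x, Set.Icc.convexComb_le h x⟩
  · have : seg s t x = seg t s (σ x) := (Set.Icc.convexComb_symm t s x).symm
    rw [this]
    exact hJ.out ht hs ⟨Set.Icc.le_convexComb h _, Set.Icc.convexComb_le h _⟩

theorem continuous_seg_uncurry {Z : Type*} [TopologicalSpace Z] {f g h : Z → I}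
    (hf : Continuous f) (hg : Continuous g) (hh : Continuous h) :
    Continuous fun z => seg (f z) (g z) (h z) :=
  Set.Icc.continuous_convexComb_prod.comp (hf.prodMk (hg.prodMk hh))

/-! ### Transports, their primitives and their extension from small curves -/

variable {X : Type*} [TopologicalSpace X] {H : Type*} [Group H]

/-- The horizontal slice at height `t` of a square. -/
def row (S : C(I × I, X)) (t : I) : C(I, X) := S.comp ⟨fun x => (x, t), by fun_prop⟩

/-- The vertical slice at abscissa `s` of a square. -/
def col (S : C(I × I, X)) (s : I) : C(I, X) := S.comp ⟨fun y => (s, y), by fun_prop⟩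

/-- A transport along the curves of `X` with values in a group, whose value along
constant curves is trivial and which commutes around all squares that lie in a member of `𝒲`. -/
structure IsTransport (𝒲 : Set (Set X)) (φ : C(I, X) → H) : Prop where
  const : ∀ x, φ (ContinuousMap.const I x) = 1
  square : ∀ S : C(I × I, X), (∃ W ∈ 𝒲, ∀ z, S z ∈ W) →
    φ (row S 0) * φ (col S 1) = φ (col S 0) * φ (row S 1)

/-- `f` is a primitive of `φ` along the curve `c`. -/
def IsPrimitive (φ : C(I, X) → H) (c : C(I, X)) (f : I → H) : Prop :=
  ∀ s, ∀ᶠ t in 𝓝 s, f t = f s * φ (c.comp (seg s t))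

/-- The quotient `f s * (g s)⁻¹` is locally constant, since the factors `φ` cancel, and the interval
is connected. -/
theorem IsPrimitive.ext {φ : C(I, X) → H} {c : C(I, X)} {f g : I → H} (hf : IsPrimitive φ c f)
    (hg : IsPrimitive φ c g) (h0 : f 0 = g 0) : f = g := by
  have hl : IsLocallyConstant fun s => f s * (g s)⁻¹ := by
    rw [IsLocallyConstant.iff_eventually_eq]
    intro s
    filter_upwards [hf s, hg s] with t h1 h2
    rw [h1, h2]
    group
  funext s
  have := hl.apply_eq_of_preconnectedSpace s 0
  simp only [h0, mul_inv_cancel] at this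
  exact mul_inv_eq_one.1 this

namespace IsTransport

variable {𝒲 : Set (Set X)} {φ : C(I, X) → H}

theorem map {K : Type*} [Group K] (h : IsTransport 𝒲 φ) (g : H →* K) :
    IsTransport 𝒲 fun c => g (φ c) where
  const x := by rw [h.const, map_one]
  square S hS := by rw [← map_mul, ← map_mul, h.square S hS]

theorem comap {Y : Type*} [TopologicalSpace Y] (h : IsTransport {Set.univ} φ) (f : C(Y, X)) :
    IsTransport {Set.univ} fun c : C(I, Y) => φ (f.comp c) where
  const x := h.const (f x)
  square S _ := h.square (f.comp S) ⟨_, rfl, fun _ => trivial⟩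

theorem seg_mul_seg (h : IsTransport 𝒲 φ) {W : Set X} (hW : W ∈ 𝒲) (c : C(I, X)) {J : Set I}
    [J.OrdConnected] (hJ : ∀ x ∈ J, c x ∈ W) {r s t : I} (hr : r ∈ J) (hs : s ∈ J) (ht : t ∈ J) :
    φ (c.comp (seg r s)) * φ (c.comp (seg s t)) = φ (c.comp (seg r t)) := by
  let S : C(I × I, X) := c.comp ⟨fun z => seg (seg r s z.1) (seg r t z.1) z.2,
    continuous_seg_uncurry (by fun_prop) (by fun_prop) (by fun_prop)⟩
  have hS := h.square S ⟨W, hW, fun z => hJ _ (seg_mem (seg_mem hr hs _) (seg_mem hr ht _) _)⟩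
  have h1 : row S 0 = c.comp (seg r s) :=
    ContinuousMap.ext fun x => congrArg c (seg_zero _ _)
  have h2 : row S 1 = c.comp (seg r t) :=
    ContinuousMap.ext fun x => congrArg c (seg_one _ _)
  have h3 : col S 1 = c.comp (seg s t) :=
    ContinuousMap.ext fun x => congrArg c (by simp [seg_one])
  have h4 : col S 0 = ContinuousMap.const I (c r) :=
    ContinuousMap.ext fun x => congrArg c (by simp [seg_zero, seg_self])
  rwa [h1, h2, h3, h4, h.const, one_mul] at hS

theorem seg_self (h : IsTransport 𝒲 φ) (c : C(I, X)) (s : I) : φ (c.comp (seg s s)) = 1 := by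
  rw [VanKampen.seg_self]
  exact h.const (c s)

theorem isPrimitive_of_small (h : IsTransport 𝒲 φ) {W : Set X} (hW : W ∈ 𝒲) (c : C(I, X))
    (hc : ∀ x, c x ∈ W) : IsPrimitive φ c fun s => φ (c.comp (seg 0 s)) := fun _ =>
  Eventually.of_forall fun _ =>
    (h.seg_mul_seg hW c (J := Set.univ) (fun x _ => hc x) trivial trivial trivial).symm

/-- Induction over the subdivision: past `t n` the primitive is continued by `f (t n)` times the
transport from `t n`. The restriction `r ≤ t n` in the conclusion keeps the condition at the right
end one-sided; it becomes vacuous when `t n = 1`. -/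
theorem exists_primitive_Iic (h : IsTransport 𝒲 φ) (c : C(I, X)) {t : ℕ → I} (ht0 : t 0 = 0)
    (htW : ∀ n, ∃ W ∈ 𝒲, ∀ x ∈ Set.Icc (t n) (t (n + 1)), c x ∈ W) (n : ℕ) :
    ∃ f : I → H, f 0 = 1 ∧
      ∀ s ≤ t n, ∀ᶠ r in 𝓝 s, r ≤ t n → f r = f s * φ (c.comp (seg s r)) := by
  induction n with
  | zero =>
    refine ⟨fun _ => 1, rfl, fun s hs => Eventually.of_forall fun r hr => ?_⟩
    rw [ht0] at hs hr
    rw [le_antisymm hs nonneg', le_antisymm hr nonneg', h.seg_self, one_mul]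
  | succ n ih =>
    obtain ⟨f, hf0, hf⟩ := ih
    obtain ⟨W, hW, hc⟩ := htW n
    have key : ∀ {r s u : I}, r ∈ Set.Icc (t n) (t (n + 1)) → s ∈ Set.Icc (t n) (t (n + 1)) →
        u ∈ Set.Icc (t n) (t (n + 1)) →
        φ (c.comp (seg r s)) * φ (c.comp (seg s u)) = φ (c.comp (seg r u)) :=
      fun hr hs hu => h.seg_mul_seg hW c hc hr hs hu
    refine ⟨fun r => if r ≤ t n then f r else f (t n) * φ (c.comp (seg (t n) r)), ?_, ?_⟩
    · simp only [if_pos nonneg', hf0]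
    · intro s hs
      rcases lt_trichotomy s (t n) with hlt | heq | hgt
      · filter_upwards [hf s hlt.le, gt_mem_nhds hlt] with r hr hrt _
        rw [if_pos hlt.le, if_pos hrt.le, hr hrt.le]
      · filter_upwards [hf s heq.le] with r hr _
        rw [if_pos heq.le]
        split_ifs with hrt
        · exact hr hrt
        · rw [heq]
      · filter_upwards [lt_mem_nhds hgt] with r hr hr'
        rw [if_neg hgt.not_ge, if_neg (not_le.2 hr), mul_assoc, key]
        · exact ⟨le_rfl, hgt.le.trans hs⟩
        · exact ⟨hgt.le, hs⟩
        · exact ⟨hr.le, hr'⟩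

theorem exists_primitive (h : IsTransport 𝒲 φ) (hopen : ∀ W ∈ 𝒲, IsOpen W) (hcov : ⋃₀ 𝒲 = Set.univ)
    (c : C(I, X)) : ∃ f : I → H, f 0 = 1 ∧ IsPrimitive φ c f := by
  obtain ⟨t, ht0, -, ⟨n, hn⟩, htW⟩ := exists_monotone_Icc_subset_open_cover_unitInterval
    (c := fun W : 𝒲 => c ⁻¹' W.1) (fun W => (hopen _ W.2).preimage c.continuous) (by
      intro x _
      obtain ⟨W, hW, hx⟩ := Set.mem_sUnion.1 (hcov.symm.subset (Set.mem_univ (c x)))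
      exact Set.mem_iUnion.2 ⟨⟨W, hW⟩, hx⟩)
  obtain ⟨f, hf0, hf⟩ := h.exists_primitive_Iic c ht0
    (fun n => (htW n).elim fun W hW => ⟨W.1, W.2, hW⟩) n
  refine ⟨f, hf0, fun s => ?_⟩
  have h1 : t n = 1 := hn n le_rfl
  rw [h1] at hf
  exact (hf s le_one').mono fun r hr => hr le_one'

theorem eventually_small (hopen : ∀ W ∈ 𝒲, IsOpen W) (hcov : ⋃₀ 𝒲 = Set.univ) (c : C(I, X))
    (s : I) : ∃ W ∈ 𝒲, ∀ᶠ t in 𝓝 s, ∀ x, c (seg s t x) ∈ W := by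
  obtain ⟨W, hW, hx⟩ := Set.mem_sUnion.1 (hcov.symm.subset (Set.mem_univ (c s)))
  refine ⟨W, hW, ?_⟩
  obtain ⟨l, r, hs, hn, hsub⟩ := exists_Icc_mem_subset_of_mem_nhds
    (((hopen W hW).preimage c.continuous).mem_nhds hx)
  filter_upwards [hn] with t ht x using hsub (seg_mem hs ht x)

/-- Transports are determined by their values along the curves that lie in a member
of an open cover. -/
theorem eq_of_small {ψ : C(I, X) → H} (hφ : IsTransport {Set.univ} φ)
    (hψ : IsTransport {Set.univ} ψ) (hopen : ∀ W ∈ 𝒲, IsOpen W) (hcov : ⋃₀ 𝒲 = Set.univ)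
    (hsmall : ∀ c : C(I, X), (∃ W ∈ 𝒲, ∀ x, c x ∈ W) → φ c = ψ c) (c : C(I, X)) : φ c = ψ c := by
  have h1 := hφ.isPrimitive_of_small rfl c fun _ => trivial
  -- By the hypothesis on small curves, `ψ` along initial segments is a primitive for `φ` too, so
  -- uniqueness of primitives applies.
  have h2 : IsPrimitive φ c fun s => ψ (c.comp (seg 0 s)) := by
    intro s
    obtain ⟨W, hW, hs⟩ := eventually_small hopen hcov c s
    filter_upwards [hψ.isPrimitive_of_small rfl c (fun _ => trivial) s, hs] with t ht hs
    rw [hsmall _ ⟨W, hW, hs⟩]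
    exact ht
  have := congrFun (h1.ext h2 (by simp only [hφ.seg_self, hψ.seg_self])) 1
  simpa only [seg_zero_one, ContinuousMap.comp_id] using this

/-- By compactness of the row, for `y'` close to `y` each thin rectangle over a short interval near
any `x` lies in one member of the cover. Commutation around it exchanges the step along row `y`
followed by the vertical step with the vertical step followed by the step along row `y'`. -/
theorem isPrimitive_row (h : IsTransport 𝒲 φ) (hopen : ∀ W ∈ 𝒲, IsOpen W)
    (hcov : ⋃₀ 𝒲 = Set.univ) (S : C(I × I, X)) {f : I → H} {y : I}
    (hf : IsPrimitive φ (row S y) f) :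
    ∀ᶠ y' in 𝓝 y, IsPrimitive φ (row S y') fun x => f x * φ ((col S x).comp (seg y y')) := by
  have hloc : ∀ᶠ y' in 𝓝 y, ∀ x ∈ (Set.univ : Set I), ∃ W ∈ 𝒲, ∀ᶠ x' in 𝓝 x,
      ∀ z : I × I, S (seg x x' z.1, seg y y' z.2) ∈ W := by
    apply isCompact_univ.eventually_forall_of_forall_eventually
    intro x _
    obtain ⟨W, hW, hx⟩ := Set.mem_sUnion.1 (hcov.symm.subset (Set.mem_univ (S (x, y))))
    have hn : S ⁻¹' W ∈ 𝓝 (x, y) := ((hopen W hW).preimage S.continuous).mem_nhds hx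
    obtain ⟨P, hP, Q, hQ, hPQ⟩ := mem_nhds_prod_iff.1 hn
    obtain ⟨l, r, hs, hlr, hsub⟩ := exists_Icc_mem_subset_of_mem_nhds hP
    obtain ⟨l', r', hs', hlr', hsub'⟩ := exists_Icc_mem_subset_of_mem_nhds hQ
    have h2 : ∀ᶠ x'' in 𝓝 x, Set.Icc l r ∈ 𝓝 x'' := eventually_mem_nhds_iff.2 hlr
    rw [nhds_prod_eq]
    refine (Filter.Eventually.prod_mk hlr' h2).mono ?_
    rintro ⟨y', x''⟩ ⟨hy', hx''⟩
    refine ⟨W, hW, ?_⟩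
    filter_upwards [hx''] with x' hx' z
    exact hPQ ⟨hsub (seg_mem (mem_of_mem_nhds hx'') hx' _), hsub' (seg_mem hs' hy' _)⟩
  filter_upwards [hloc] with y' hy' x
  obtain ⟨W, hW, hx⟩ := hy' x trivial
  filter_upwards [hx, hf x] with x' hx' hfx
  have hsq := h.square (S.comp ⟨fun z => (seg x x' z.1, seg y y' z.2), by fun_prop⟩) ⟨W, hW, hx'⟩
  have h1 : row (S.comp ⟨fun z => (seg x x' z.1, seg y y' z.2), by fun_prop⟩) 0 =
      (row S y).comp (seg x x') :=
    ContinuousMap.ext fun u => congrArg S (Prod.ext rfl (seg_zero _ _))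
  have h2 : row (S.comp ⟨fun z => (seg x x' z.1, seg y y' z.2), by fun_prop⟩) 1 =
      (row S y').comp (seg x x') :=
    ContinuousMap.ext fun u => congrArg S (Prod.ext rfl (seg_one _ _))
  have h3 : col (S.comp ⟨fun z => (seg x x' z.1, seg y y' z.2), by fun_prop⟩) 0 =
      (col S x).comp (seg y y') :=
    ContinuousMap.ext fun u => congrArg S (Prod.ext (seg_zero _ _) rfl)
  have h4 : col (S.comp ⟨fun z => (seg x x' z.1, seg y y' z.2), by fun_prop⟩) 1 =
      (col S x').comp (seg y y') :=
    ContinuousMap.ext fun u => congrArg S (Prod.ext (seg_one _ _) rfl)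
  rw [h1, h2, h3, h4] at hsq
  rw [hfx, mul_assoc, hsq, mul_assoc]

/-- A transport that commutes around the squares lying in the members of an open cover extends
from the curves lying in the members of the cover to a transport that commutes around all
squares. -/
theorem exists_extension (h : IsTransport 𝒲 φ) (hopen : ∀ W ∈ 𝒲, IsOpen W)
    (hcov : ⋃₀ 𝒲 = Set.univ) :
    ∃ ψ : C(I, X) → H, IsTransport {Set.univ} ψ ∧
      ∀ c : C(I, X), (∃ W ∈ 𝒲, ∀ x, c x ∈ W) → ψ c = φ c := by
  choose f hf0 hf using h.exists_primitive hopen hcov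
  have hsmall : ∀ c : C(I, X), (∃ W ∈ 𝒲, ∀ x, c x ∈ W) → f c 1 = φ c := by
    rintro c ⟨W, hW, hc⟩
    have := congrFun ((hf c).ext (h.isPrimitive_of_small hW c hc) (by rw [hf0, h.seg_self])) 1
    simpa only [seg_zero_one, ContinuousMap.comp_id] using this
  refine ⟨fun c => f c 1, ⟨fun x => ?_, fun S _ => ?_⟩, hsmall⟩
  · obtain ⟨W, hW, hx⟩ := Set.mem_sUnion.1 (hcov.symm.subset (Set.mem_univ x))
    rw [hsmall _ ⟨W, hW, fun _ => hx⟩, h.const]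
  -- Transport up the left side to height `y`, across, and back down the right side. At `y = 0` and
  -- `y = 1` the values are the two sides of the square identity, up to the factor of the right
  -- side.
  · have hl : IsLocallyConstant fun y => f (col S 0) y * f (row S y) 1 * (f (col S 1) y)⁻¹ := by
      rw [IsLocallyConstant.iff_eventually_eq]
      intro y
      filter_upwards [h.isPrimitive_row hopen hcov S (hf (row S y)), hf (col S 0) y,
        hf (col S 1) y] with y' h1 h2 h3
      -- The primitive carried over from row `y`, multiplied on the left by a constant so that it
      -- starts at `1`.
      have h4 : IsPrimitive φ (row S y') fun x => (φ ((col S 0).comp (seg y y')))⁻¹ *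
          (f (row S y) x * φ ((col S x).comp (seg y y'))) := by
        intro x
        filter_upwards [h1 x] with x' hx'
        rw [hx']
        group
      have h5 := congrFun ((hf (row S y')).ext h4 (by simp [hf0])) 1
      rw [h5, h2, h3]
      group
    have := hl.apply_eq_of_preconnectedSpace 0 1
    simp only [hf0, one_mul] at this
    rw [inv_one, mul_one] at this
    rw [this]
    group

end IsTransport

/-! ### Transports and fundamental groups -/

namespace IsTransport

variable {φ : C(I, X) → H}

/-- A homotopy with fixed endpoints is a square with two opposite sides constant. -/
theorem eq_of_homotopic (h : IsTransport {Set.univ} φ) {x y : X} {γ δ : Path x y}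
    (hγ : γ.Homotopic δ) : φ γ.toContinuousMap = φ δ.toContinuousMap := by
  obtain ⟨F⟩ := hγ
  have hS := h.square F.toContinuousMap ⟨_, rfl, fun _ => trivial⟩
  have h1 : row F.toContinuousMap 0 = ContinuousMap.const I x :=
    ContinuousMap.ext fun u => F.source u
  have h2 : row F.toContinuousMap 1 = ContinuousMap.const I y :=
    ContinuousMap.ext fun u => F.target u
  have h3 : col F.toContinuousMap 0 = γ.toContinuousMap := ContinuousMap.ext fun u => F.apply_zero u
  have h4 : col F.toContinuousMap 1 = δ.toContinuousMap := ContinuousMap.ext fun u => F.apply_one u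
  rw [h1, h2, h3, h4, h.const, h.const, one_mul, mul_one] at hS
  exact hS.symm

theorem map_trans (h : IsTransport {Set.univ} φ) {x y z : X} (γ : Path x y) (δ : Path y z) :
    φ (γ.trans δ).toContinuousMap = φ γ.toContinuousMap * φ δ.toContinuousMap := by
  let m : I := ⟨1 / 2, by norm_num, by norm_num⟩
  have hS := h.seg_mul_seg (J := Set.univ) (r := 0) (s := m) (t := 1) rfl
    (γ.trans δ).toContinuousMap (fun _ _ => trivial) trivial trivial trivial
  have h1 : (γ.trans δ).toContinuousMap.comp (seg 0 m) = γ.toContinuousMap := by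
    ext u
    have hu : ((seg 0 m u : I) : ℝ) = u / 2 := by
      simp [seg, Set.Icc.coe_convexComb, m, div_eq_mul_inv]
    change (γ.trans δ) (seg 0 m u) = γ u
    have hu1 : (u : ℝ) ≤ 1 := u.2.2
    rw [Path.trans_apply, dif_pos (by rw [hu]; linarith)]
    congr 1
    ext
    simp only [hu]
    ring
  have h2 : (γ.trans δ).toContinuousMap.comp (seg m 1) = δ.toContinuousMap := by
    ext u
    have hu : ((seg m 1 u : I) : ℝ) = (1 + u) / 2 := by
      simp [seg, Set.Icc.coe_convexComb, m]
      ring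
    change (γ.trans δ) (seg m 1 u) = δ u
    have hu0 : 0 ≤ (u : ℝ) := u.2.1
    have hu1 : (u : ℝ) ≤ 1 := u.2.2
    rw [Path.trans_apply]
    -- The first branch occurs only at the midpoint, where `u = 0` and both halves take the value
    -- `y`.
    split_ifs with hc
    · rw [hu] at hc
      have : u = 0 := Subtype.ext (show (u : ℝ) = 0 by linarith)
      subst this
      rw [Path.source]
      convert γ.target
      norm_num [hu]
    · congr 1
      ext
      simp only [hu]
      ring
  rw [h1, h2, seg_zero_one, ContinuousMap.comp_id] at hS
  exact hS.symm

theorem map_symm (h : IsTransport {Set.univ} φ) {x y : X} (γ : Path x y) :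
    φ γ.symm.toContinuousMap = (φ γ.toContinuousMap)⁻¹ := by
  rw [eq_inv_iff_mul_eq_one, ← h.map_trans, h.eq_of_homotopic (Path.Homotopic.symm_trans γ)]
  exact h.const y

/-- The homomorphism that a transport induces on a fundamental group. -/
noncomputable def toHom (h : IsTransport {Set.univ} φ) (x : X) : PiOne X x →* H :=
  MonoidHom.mk'
    (fun g => Quotient.lift (fun γ : Path x x => φ γ.toContinuousMap)
      (fun _ _ hγ => h.eq_of_homotopic hγ) g.unop)
    (by
      rintro ⟨g⟩ ⟨g'⟩
      induction g using Quotient.inductionOn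
      induction g' using Quotient.inductionOn
      exact h.map_trans _ _)

end IsTransport

/-- The class of a curve in the fundamental groupoid. -/
def arrow (c : C(I, X)) : Path.Homotopic.Quotient (c 0) (c 1) :=
  Path.Homotopic.Quotient.mk ⟨c, rfl, rfl⟩

/-- The element of the fundamental group given by a class of loops. -/
noncomputable def PiOne.ofClass {x : X} (g : Path.Homotopic.Quotient x x) : PiOne X x :=
  op (FundamentalGroup.fromPath g)

theorem PiOne.ofClass_trans {x : X} (g g' : Path.Homotopic.Quotient x x) :
    PiOne.ofClass (g.trans g') = PiOne.ofClass g * PiOne.ofClass g' := rfl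

theorem PiOne.ofClass_refl (x : X) : PiOne.ofClass (.refl x) = (1 : PiOne X x) := rfl

theorem PiOne.exists_ofLoop {x : X} (g : PiOne X x) : ∃ γ : Path x x, PiOne.ofLoop γ = g := by
  obtain ⟨g⟩ := g
  induction g using Quotient.inductionOn
  exact ⟨_, rfl⟩

/-- The two boundary paths are already homotopic in the simply connected square `I × I`; the
homotopy is pushed forward along `S`. -/
theorem arrow_square (S : C(I × I, X)) :
    Path.Homotopic.Quotient.trans (x₀ := S (0, 0)) (x₁ := S (1, 0)) (x₂ := S (1, 1))
      (arrow (row S 0)) (arrow (col S 1)) =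
    Path.Homotopic.Quotient.trans (x₀ := S (0, 0)) (x₁ := S (0, 1)) (x₂ := S (1, 1))
      (arrow (col S 0)) (arrow (row S 1)) := by
  let bottom : Path ((0, 0) : I × I) (1, 0) := ⟨⟨fun x => (x, 0), by fun_prop⟩, rfl, rfl⟩
  let top : Path ((0, 1) : I × I) (1, 1) := ⟨⟨fun x => (x, 1), by fun_prop⟩, rfl, rfl⟩
  let left : Path ((0, 0) : I × I) (0, 1) := ⟨⟨fun x => (0, x), by fun_prop⟩, rfl, rfl⟩
  let right : Path ((1, 0) : I × I) (1, 1) := ⟨⟨fun x => (1, x), by fun_prop⟩, rfl, rfl⟩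
  have : ContractibleSpace I := (convex_Icc (0 : ℝ) 1).contractibleSpace ⟨0, zero_mem⟩
  have h := (SimplyConnectedSpace.paths_homotopic (bottom.trans right) (left.trans top)).map S
  rw [Path.map_trans, Path.map_trans] at h
  exact Quotient.sound h

/-- The transport obtained from a homomorphism on the fundamental group, from paths connecting the
base point with all points, and from a gauge function. -/
noncomputable def basedTransport {x : X} (j : PiOne X x →* H) (C : ∀ z, Path.Homotopic.Quotient x z)
    (u : X → H) (c : C(I, X)) : H :=
  (u (c 0))⁻¹ * j (PiOne.ofClass ((C (c 0)).trans ((arrow c).trans (C (c 1)).symm))) * u (c 1)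

theorem isTransport_basedTransport {x : X} (j : PiOne X x →* H)
    (C : ∀ z, Path.Homotopic.Quotient x z) (u : X → H) :
    IsTransport {Set.univ} (basedTransport j C u) where
  const z := by
    have h : arrow (ContinuousMap.const I z) = .refl z := rfl
    simp only [basedTransport, h]
    change (u z)⁻¹ * j (PiOne.ofClass ((C z).trans ((Path.Homotopic.Quotient.refl z).trans
      (C z).symm))) * u z = 1
    simp [PiOne.ofClass_refl]
  square S _ := by
    -- Consecutive values multiply: the gauge and the connecting path at the intermediate point
    -- cancel.
    have key : ∀ {y z w : X} (g : Path.Homotopic.Quotient y z) (g' : Path.Homotopic.Quotient z w),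
        ((u y)⁻¹ * j (PiOne.ofClass ((C y).trans (g.trans (C z).symm))) * u z) *
        ((u z)⁻¹ * j (PiOne.ofClass ((C z).trans (g'.trans (C w).symm))) * u w) =
        (u y)⁻¹ * j (PiOne.ofClass ((C y).trans ((g.trans g').trans (C w).symm))) * u w := by
      intro y z w g g'
      have : (C y).trans ((g.trans g').trans (C w).symm) =
          ((C y).trans (g.trans (C z).symm)).trans ((C z).trans (g'.trans (C w).symm)) := by
        simp only [Path.Homotopic.Quotient.trans_assoc]
        rw [← Path.Homotopic.Quotient.trans_assoc (C z).symm,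
          Path.Homotopic.Quotient.symm_trans, Path.Homotopic.Quotient.refl_trans]
      rw [this, PiOne.ofClass_trans, map_mul]
      group
    refine (key (y := S (0, 0)) (z := S (1, 0)) (w := S (1, 1)) _ _).trans
      (Eq.trans ?_ (key (y := S (0, 0)) (z := S (0, 1)) (w := S (1, 1)) _ _).symm)
    rw [arrow_square]

theorem basedTransport_path {x : X} (j : PiOne X x →* H) (C : ∀ z, Path.Homotopic.Quotient x z)
    (u : X → H) {y z : X} (γ : Path y z) :
    basedTransport j C u γ.toContinuousMap = (u y)⁻¹ * j (PiOne.ofClass ((C y).trans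
      ((Path.Homotopic.Quotient.mk γ).trans (C z).symm))) * u z := by
  rcases γ with ⟨c, rfl, rfl⟩
  rfl

/-! ### Functoriality of path classes -/

section Functoriality

variable {Y : Type*} [TopologicalSpace Y]

theorem map_trans {x y z : X} (g : Path.Homotopic.Quotient x y) (g' : Path.Homotopic.Quotient y z)
    (f : C(X, Y)) : (g.trans g').map f = (g.map f).trans (g'.map f) := by
  induction g using Quotient.inductionOn
  induction g' using Quotient.inductionOn
  exact congrArg Path.Homotopic.Quotient.mk (Path.map_trans _ _ f.continuous)

theorem map_symm {x y : X} (g : Path.Homotopic.Quotient x y) (f : C(X, Y)) :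
    g.symm.map f = (g.map f).symm := by
  induction g using Quotient.inductionOn
  rfl

theorem symm_trans_rev {x y z : X} (g : Path.Homotopic.Quotient x y)
    (g' : Path.Homotopic.Quotient y z) : (g.trans g').symm = g'.symm.trans g.symm := by
  induction g using Quotient.inductionOn
  induction g' using Quotient.inductionOn
  exact congrArg Path.Homotopic.Quotient.mk (Path.trans_symm _ _)

theorem PiOne.ofClass_symm {x : X} (g : Path.Homotopic.Quotient x x) :
    PiOne.ofClass g.symm = (PiOne.ofClass g)⁻¹ := rfl

theorem PiOne.exists_ofClass {x : X} (g : PiOne X x) :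
    ∃ γ : Path.Homotopic.Quotient x x, PiOne.ofClass γ = g :=
  ⟨g.unop, rfl⟩

theorem PiOne.map_ofClass (f : C(X, Y)) {x : X} (g : Path.Homotopic.Quotient x x) :
    PiOne.map f rfl (PiOne.ofClass g) = PiOne.ofClass (g.map f) := by
  induction g using Quotient.inductionOn
  exact PiOne.map_ofLoop f rfl _

theorem PiOne.changeBase_ofClass {b a : X} (p : Path b a) (g : Path.Homotopic.Quotient a a) :
    PiOne.changeBase p (PiOne.ofClass g) =
      PiOne.ofClass ((Path.Homotopic.Quotient.mk p).trans
        (g.trans (Path.Homotopic.Quotient.mk p).symm)) := by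
  induction g using Quotient.inductionOn
  exact PiOne.changeBase_ofLoop p _

theorem arrow_comp (f : C(X, Y)) (c : C(I, X)) : arrow (f.comp c) = (arrow c).map f := rfl

theorem PiOne.changeBase_map_ofClass (f : C(X, Y)) {a x y : X} {b : Y} (r : Path b (f a))
    (d : Path.Homotopic.Quotient a x) (d' : Path.Homotopic.Quotient a y)
    (g : Path.Homotopic.Quotient x y) :
    PiOne.changeBase r (PiOne.map f rfl (PiOne.ofClass (d.trans (g.trans d'.symm)))) =
      PiOne.ofClass (((Path.Homotopic.Quotient.mk r).trans (d.map f)).trans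
        ((g.map f).trans ((Path.Homotopic.Quotient.mk r).trans (d'.map f)).symm)) := by
  rw [PiOne.map_ofClass, PiOne.changeBase_ofClass]
  simp only [map_trans, map_symm, symm_trans_rev, Path.Homotopic.Quotient.trans_assoc]

end Functoriality

/-! ### Gluing transports over a cover by two open sets -/

/-- The inclusion of a subset. -/
def incl (U : Set X) : C(U, X) := ⟨Subtype.val, continuous_subtype_val⟩

theorem exists_incl_comp {Z : Type*} [TopologicalSpace Z] {W : Set X} (c : C(Z, X))
    (hc : ∀ x, c x ∈ W) : ∃ c' : C(Z, W), (incl W).comp c' = c :=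
  ⟨⟨fun x => ⟨c x, hc x⟩, by fun_prop⟩, rfl⟩

theorem incl_comp_injective {Z : Type*} [TopologicalSpace Z] {W : Set X} {c c' : C(Z, W)}
    (h : (incl W).comp c = (incl W).comp c') : c = c' :=
  ContinuousMap.ext fun x => Subtype.ext (DFunLike.congr_fun h x)

/-- Transports on the two members of an open cover that agree on the intersection come
from a transport on the whole space. -/
theorem exists_transport_of_cover {U V : Set X} (hU : IsOpen U) (hV : IsOpen V)
    (hX : U ∪ V = Set.univ) {φ : C(I, U) → H} {ψ : C(I, V) → H} (hφ : IsTransport {Set.univ} φ)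
    (hψ : IsTransport {Set.univ} ψ)
    (hφψ : ∀ (c : C(I, U)) (c' : C(I, V)), (incl U).comp c = (incl V).comp c' → φ c = ψ c') :
    ∃ χ : C(I, X) → H, IsTransport {Set.univ} χ ∧ (∀ c, χ ((incl U).comp c) = φ c) ∧
      ∀ c, χ ((incl V).comp c) = ψ c := by
  classical
  let χ : C(I, X) → H := fun c =>
    if h : ∃ c' : C(I, U), (incl U).comp c' = c then φ h.choose
    -- The value `1` on curves contained in neither set is arbitrary: no square inside `U` or `V`
    -- involves such a curve, and the extension below replaces the value.
    else if h : ∃ c' : C(I, V), (incl V).comp c' = c then ψ h.choose else 1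
  have hχU : ∀ c, χ ((incl U).comp c) = φ c := by
    intro c
    have h : ∃ c' : C(I, U), (incl U).comp c' = (incl U).comp c := ⟨c, rfl⟩
    simp only [χ, dif_pos h]
    exact congrArg φ (incl_comp_injective h.choose_spec)
  have hχV : ∀ c, χ ((incl V).comp c) = ψ c := by
    intro c
    by_cases h : ∃ c' : C(I, U), (incl U).comp c' = (incl V).comp c
    · simp only [χ, dif_pos h]
      exact hφψ _ _ h.choose_spec
    · have h' : ∃ c' : C(I, V), (incl V).comp c' = (incl V).comp c := ⟨c, rfl⟩
      simp only [χ, dif_neg h, dif_pos h']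
      exact congrArg ψ (incl_comp_injective h'.choose_spec)
  have hloc : IsTransport {U, V} χ := by
    refine ⟨fun x => ?_, ?_⟩
    · rcases hX.symm.subset (Set.mem_univ x) with h | h
      · exact (hχU (ContinuousMap.const I ⟨x, h⟩)).trans (hφ.const _)
      · exact (hχV (ContinuousMap.const I ⟨x, h⟩)).trans (hψ.const _)
    · rintro S ⟨W, rfl | rfl, hS⟩
      · obtain ⟨S, rfl⟩ := exists_incl_comp S hS
        have := hφ.square S ⟨_, rfl, fun _ => trivial⟩
        simp only [← hχU] at this
        exact this
      · obtain ⟨S, rfl⟩ := exists_incl_comp S hS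
        have := hψ.square S ⟨_, rfl, fun _ => trivial⟩
        simp only [← hχV] at this
        exact this
  obtain ⟨ω, hω, hωχ⟩ := hloc.exists_extension
    (by rintro W (rfl | rfl) <;> assumption) (by rw [Set.sUnion_pair, hX])
  refine ⟨ω, hω, fun c => ?_, fun c => ?_⟩
  · rw [hωχ _ ⟨U, Or.inl rfl, fun x => (c x).2⟩, hχU]
  · rw [hωχ _ ⟨V, Or.inr rfl, fun x => (c x).2⟩, hχV]

/-- Injectivity of `e` makes the prescribed values consistent; elsewhere the choice is free. It
supplies path classes to all points with prescribed classes to some of them. -/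
theorem exists_section_extension {ι Z : Type*} {Q : Z → Type*} [∀ z, Nonempty (Q z)] {e : ι → Z}
    (he : Function.Injective e) (F : ∀ i, Q (e i)) : ∃ C : ∀ z, Q z, ∀ i, C (e i) = F i := by
  have h : ∀ z, ∃ q : Q z, ∀ i (hi : e i = z), hi ▸ F i = q := by
    intro z
    by_cases hz : ∃ i, e i = z
    · obtain ⟨i, rfl⟩ := hz
      refine ⟨F i, fun k hk => ?_⟩
      obtain rfl := he hk
      rfl
    · exact ⟨Classical.arbitrary _, fun i hi => (hz ⟨i, hi⟩).elim⟩
  choose C hC using h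
  exact ⟨C, fun i => (hC _ i rfl).symm⟩

/-! ### Topology and paths of the glued space -/

section Glue

variable {U V A B : Set X}

theorem inU_injective : Function.Injective (inU U V B) := fun x y h => by
  rcases Quotient.exact h with h | h
  · exact Sum.inl_injective h
  · exact Subtype.ext h.1

theorem inV_injective : Function.Injective (inV U V B) := fun x y h => by
  rcases Quotient.exact h with h | h
  · exact Sum.inr_injective h
  · exact Subtype.ext h.1

theorem inU_eq_inV_iff {x : U} {y : V} :
    inU U V B x = inV U V B y ↔ (x : X) = y ∧ (x : X) ∈ B := by
  refine ⟨fun h => ?_, fun h => Quotient.sound (Or.inr h)⟩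
  rcases Quotient.exact h with h | h
  · exact (Sum.inl_ne_inr h).elim
  · exact h

theorem glue_cases (z : Glue U V B) : (∃ x, inU U V B x = z) ∨ ∃ x, inV U V B x = z := by
  induction z using Quotient.inductionOn with | _ s =>
  rcases s with x | x
  · exact Or.inl ⟨x, rfl⟩
  · exact Or.inr ⟨x, rfl⟩

/-- The image of the trace on `U` of an open set `O` pulls back to that trace on `U` and to the
trace of `B ∩ O` on `V`. The latter is open because `B` is open in `X`. -/
theorem isOpenEmbedding_inU (hBo : IsOpen B) (hBU : B ⊆ U) : IsOpenEmbedding (inU U V B) := by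
  refine .of_continuous_injective_isOpenMap (inU U V B).continuous inU_injective ?_
  rintro _ ⟨O, hO, rfl⟩
  refine isOpen_coinduced.2 (isOpen_sum_iff.2 ⟨?_, ?_⟩)
  · convert hO.preimage (continuous_subtype_val (p := (· ∈ U))) using 1
    ext x
    exact inU_injective.mem_set_image
  · convert (hBo.inter hO).preimage (continuous_subtype_val (p := (· ∈ V))) using 1
    ext y
    constructor
    · rintro ⟨x, hx, hxy⟩
      obtain ⟨h1, h2⟩ := inU_eq_inV_iff.1 hxy
      exact ⟨h1 ▸ h2, show (y : X) ∈ O from h1 ▸ hx⟩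
    · rintro ⟨h1, h2⟩
      exact ⟨⟨y, hBU h1⟩, h2, inU_eq_inV _ _ h1⟩

theorem isOpenEmbedding_inV (hBo : IsOpen B) (hBV : B ⊆ V) : IsOpenEmbedding (inV U V B) := by
  refine .of_continuous_injective_isOpenMap (inV U V B).continuous inV_injective ?_
  rintro _ ⟨O, hO, rfl⟩
  refine isOpen_coinduced.2 (isOpen_sum_iff.2 ⟨?_, ?_⟩)
  · convert (hBo.inter hO).preimage (continuous_subtype_val (p := (· ∈ U))) using 1
    ext y
    constructor
    · rintro ⟨x, hx, hxy⟩
      obtain ⟨h1, h2⟩ := inU_eq_inV_iff.1 hxy.symm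
      exact ⟨h2, show (y : X) ∈ O from h1 ▸ hx⟩
    · rintro ⟨h1, h2⟩
      exact ⟨⟨y, hBV h1⟩, h2, (inU_eq_inV _ _ h1).symm⟩
  · convert hO.preimage (continuous_subtype_val (p := (· ∈ V))) using 1
    ext x
    exact inV_injective.mem_set_image

theorem exists_comp_eq_of_isEmbedding {Y Z : Type*} [TopologicalSpace Y] [TopologicalSpace Z]
    {f : C(Y, X)} (hf : IsEmbedding f) (c : C(Z, X)) (hc : ∀ z, c z ∈ Set.range f) :
    ∃ c' : C(Z, Y), f.comp c' = c := by
  choose g hg using hc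
  exact ⟨⟨g, hf.continuous_iff.2 ((funext hg : f ∘ g = c) ▸ c.continuous)⟩, ContinuousMap.ext hg⟩

/-- Transports on the glued space are determined by their restrictions to the two pieces. -/
theorem transport_glue_ext (hBo : IsOpen B) (hBU : B ⊆ U) (hBV : B ⊆ V)
    {φ ψ : C(I, Glue U V B) → H} (hφ : IsTransport {Set.univ} φ) (hψ : IsTransport {Set.univ} ψ)
    (h1 : ∀ c, φ ((inU U V B).comp c) = ψ ((inU U V B).comp c))
    (h2 : ∀ c, φ ((inV U V B).comp c) = ψ ((inV U V B).comp c)) (c : C(I, Glue U V B)) :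
    φ c = ψ c := by
  have hoU := isOpenEmbedding_inU (V := V) hBo hBU
  have hoV := isOpenEmbedding_inV (U := U) hBo hBV
  refine hφ.eq_of_small hψ (𝒲 := {Set.range (inU U V B), Set.range (inV U V B)}) ?_ ?_ ?_ c
  · rintro W (rfl | rfl)
    exacts [hoU.isOpen_range, hoV.isOpen_range]
  · rw [Set.sUnion_pair]
    exact Set.eq_univ_of_forall glue_cases
  · rintro c ⟨W, rfl | rfl, hc⟩
    · obtain ⟨c, rfl⟩ := exists_comp_eq_of_isEmbedding hoU.isEmbedding c hc
      exact h1 c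
    · obtain ⟨c, rfl⟩ := exists_comp_eq_of_isEmbedding hoV.isEmbedding c hc
      exact h2 c

theorem nonempty_quotient_glue (hUc : IsPathConnected U) (hVc : IsPathConnected V) {b : X}
    (hbU : b ∈ U) (hbV : b ∈ V) (hb : b ∈ B) (z : Glue U V B) :
    Nonempty (Path.Homotopic.Quotient (inV U V B ⟨b, hbV⟩) z) := by
  have := isPathConnected_iff_pathConnectedSpace.1 hUc
  have := isPathConnected_iff_pathConnectedSpace.1 hVc
  rcases glue_cases z with ⟨x, rfl⟩ | ⟨x, rfl⟩
  · obtain ⟨γ⟩ := PathConnectedSpace.joined (⟨b, hbU⟩ : U) x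
    exact ⟨.mk ((γ.map (inU U V B).continuous).cast (inU_eq_inV hbU hbV hb).symm rfl)⟩
  · obtain ⟨γ⟩ := PathConnectedSpace.joined (⟨b, hbV⟩ : V) x
    exact ⟨.mk (γ.map (inV U V B).continuous)⟩

theorem mem_pathComponentIn_of_curve {F : Set X} {x : X} (c : C(I, X)) (hc : ∀ s, c s ∈ F)
    {s : I} (hs : c s ∈ pathComponentIn F x) (t : I) : c t ∈ pathComponentIn F x := by
  have h : JoinedIn F (c s) (c t) :=
    ⟨⟨c.comp (seg s t), congrArg c (seg_zero s t), congrArg c (seg_one s t)⟩, fun _ => hc _⟩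
  exact JoinedIn.trans hs h

end Glue

theorem mk_inl_eq_conj {K G : Type*} [Group K] [Group G] (θ θhat : K →* G) (α : K) :
    (QuotientGroup.mk (Monoid.Coprod.inl (θhat α)) : FreeProductWithRelation θ θhat) =
      QuotientGroup.mk (Monoid.Coprod.inr t) * QuotientGroup.mk (Monoid.Coprod.inl (θ α)) *
        (QuotientGroup.mk (Monoid.Coprod.inr t))⁻¹ := by
  rw [← mul_inv_eq_one]
  exact (QuotientGroup.eq_one_iff _).2 (Subgroup.subset_normalClosure ⟨α, rfl⟩)

/-! ### Framing, gauge, descent to `X`, and the homomorphism to `π₁(X, b)` -/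

section HNN

variable {U V A B : Set X} {a b : X}

/-- The map of `A` to the glued space through `V`. -/
def viaV (hUV : U ∩ V = A ∪ B) : C(A, Glue U V B) :=
  (inV U V B).comp (ContinuousMap.inclusion (left_subset_V hUV))

/-- The map of `A` to the glued space through the copy of `U`. -/
def viaU (hUV : U ∩ V = A ∪ B) : C(A, Glue U V B) :=
  (inU U V B).comp (ContinuousMap.inclusion (left_subset_U hUV))

/-- The base point of the glued space. -/
def basePt (U : Set X) (hUV : U ∩ V = A ∪ B) (hb : b ∈ B) : Glue U V B :=
  inV U V B ⟨b, right_subset_V hUV hb⟩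

/-- A path in `V`, regarded as a path in the glued space. -/
def pathV (hUV : U ∩ V = A ∪ B) (ha : a ∈ A) (hb : b ∈ B)
    (q : Path (⟨b, right_subset_V hUV hb⟩ : V) ⟨a, left_subset_V hUV ha⟩) :
    Path (basePt U hUV hb) (viaV hUV ⟨a, ha⟩) :=
  q.map (inV U V B).continuous

/-- The copy in the glued space of a path in `U`. -/
def pathU (hUV : U ∩ V = A ∪ B) (ha : a ∈ A) (hb : b ∈ B)
    (p : Path (⟨b, right_subset_U hUV hb⟩ : U) ⟨a, left_subset_U hUV ha⟩) :
    Path (basePt U hUV hb) (viaU hUV ⟨a, ha⟩) :=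
  (p.map (inU U V B).continuous).cast
    (inU_eq_inV (right_subset_U hUV hb) (right_subset_V hUV hb) hb).symm rfl

theorem viaU_ne_inV (hUV : U ∩ V = A ∪ B) (hAB : Disjoint A B) (x : A) (y : V) :
    viaU hUV x ≠ inV U V B y := fun h =>
  Set.disjoint_left.1 hAB x.2 (inU_eq_inV_iff.1 h).2

theorem viaV_injective (hUV : U ∩ V = A ∪ B) : Function.Injective (viaV hUV) :=
  inV_injective.comp (Set.inclusion_injective (left_subset_V hUV))

theorem viaU_injective (hUV : U ∩ V = A ∪ B) : Function.Injective (viaU hUV) :=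
  inU_injective.comp (Set.inclusion_injective (left_subset_U hUV))

theorem viaV_ne_basePt (hUV : U ∩ V = A ∪ B) (hAB : Disjoint A B) (hb : b ∈ B) (x : A) :
    viaV hUV x ≠ basePt U hUV hb := fun h => by
  have h' : (x : X) = b := congrArg Subtype.val (inV_injective h)
  exact Set.disjoint_left.1 hAB x.2 (h' ▸ hb)

/-- A choice of classes of paths from the base point to all points of the glued space, compatible
with given paths to the two copies of `A`. -/
theorem exists_framing (hUV : U ∩ V = A ∪ B) (hAB : Disjoint A B) (hb : b ∈ B)
    (hUc : IsPathConnected U) (hVc : IsPathConnected V)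
    (F : ∀ x : A, Path.Homotopic.Quotient (basePt U hUV hb) (viaV hUV x))
    (G : ∀ x : A, Path.Homotopic.Quotient (basePt U hUV hb) (viaU hUV x)) :
    ∃ C : ∀ z, Path.Homotopic.Quotient (basePt U hUV hb) z,
      C (basePt U hUV hb) = .refl _ ∧ (∀ x, C (viaV hUV x) = F x) ∧ ∀ x, C (viaU hUV x) = G x := by
  have hne (z : Glue U V B) : Nonempty (Path.Homotopic.Quotient (basePt U hUV hb) z) :=
    nonempty_quotient_glue hUc hVc (right_subset_U hUV hb) (right_subset_V hUV hb) hb z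
  let e : Unit ⊕ A ⊕ A → Glue U V B :=
    Sum.elim (fun _ => basePt U hUV hb) (Sum.elim (viaV hUV) (viaU hUV))
  -- The base point and the two copies of `A` are pairwise disjoint in the glued space because `A`
  -- and `B` are disjoint, so the classes on them can be prescribed independently.
  have he : Function.Injective e :=
    Function.Injective.sumElim (Function.injective_of_subsingleton _)
      ((viaV_injective hUV).sumElim (viaU_injective hUV)
        fun x y h => viaU_ne_inV hUV hAB y _ h.symm) (by
      rintro _ (x | x) h
      · exact viaV_ne_basePt hUV hAB hb x h.symm
      · exact viaU_ne_inV hUV hAB x _ h.symm)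
  obtain ⟨C, hC⟩ := exists_section_extension
    (Q := fun z => Path.Homotopic.Quotient (basePt U hUV hb) z) he
    (fun i => match i with
      | Sum.inl _ => Path.Homotopic.Quotient.refl _
      | Sum.inr (Sum.inl x) => F x
      | Sum.inr (Sum.inr x) => G x)
  exact ⟨C, hC (Sum.inl ()), fun x => hC (Sum.inr (Sum.inl x)), fun x => hC (Sum.inr (Sum.inr x))⟩

/-- The copy of `A` in `U'` misses the image of `V`, since only points of `B` are identified. With
`T` the image of `t`, this gauge absorbs the conjugation in the relation. -/
theorem exists_gauge (hUV : U ∩ V = A ∪ B) (hAB : Disjoint A B) (T : H) :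
    ∃ u : Glue U V B → H, (∀ x, u (viaU hUV x) = T) ∧ (∀ y, u (inV U V B y) = 1) ∧
      ∀ x : U, (x : X) ∉ A → u (inU U V B x) = 1 := by
  classical
  refine ⟨fun z => if z ∈ Set.range (viaU hUV) then T else 1, fun x => if_pos ⟨x, rfl⟩,
    fun y => if_neg ?_, fun x hx => if_neg ?_⟩
  · rintro ⟨x, h⟩
    exact viaU_ne_inV hUV hAB x y h
  · rintro ⟨y, h⟩
    have h' : (y : X) = x := congrArg Subtype.val (inU_injective h)
    exact hx (h' ▸ y.2)

/-- Curves in `U ∩ V` stay in `A` or in `B`. -/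
theorem curve_cases (hUV : U ∩ V = A ∪ B) (hA : A = pathComponentIn (U ∩ V) a)
    (hB : B = pathComponentIn (U ∩ V) b) (c : C(I, X)) (hc : ∀ s, c s ∈ U ∩ V) :
    (∀ s, c s ∈ A) ∨ ∀ s, c s ∈ B := by
  rcases hUV.subset (hc 0) with h | h
  · exact Or.inl fun s => hA ▸ mem_pathComponentIn_of_curve c hc (hA ▸ h) s
  · exact Or.inr fun s => hB ▸ mem_pathComponentIn_of_curve c hc (hB ▸ h) s

/-- A transport on the glued space that takes the same values along the two copies of each curve
in `A` descends to `X`. -/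
theorem exists_transport_of_glue (hU : IsOpen U) (hV : IsOpen V) (hX : U ∪ V = Set.univ)
    (hUV : U ∩ V = A ∪ B) (hA : A = pathComponentIn (U ∩ V) a)
    (hB : B = pathComponentIn (U ∩ V) b) {ψ : C(I, Glue U V B) → H}
    (hψ : IsTransport {Set.univ} ψ)
    (h : ∀ c : C(I, A), ψ ((viaU hUV).comp c) = ψ ((viaV hUV).comp c)) :
    ∃ χ : C(I, X) → H, IsTransport {Set.univ} χ ∧
      (∀ c, χ ((incl U).comp c) = ψ ((inU U V B).comp c)) ∧
      ∀ c, χ ((incl V).comp c) = ψ ((inV U V B).comp c) := by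
  refine exists_transport_of_cover hU hV hX (hψ.comap _) (hψ.comap _) fun c c' hcc => ?_
  have hcc' : ∀ s, (c s : X) = c' s := DFunLike.congr_fun hcc
  rcases curve_cases hUV hA hB ((incl U).comp c)
    (fun s => ⟨(c s).2, show (c s : X) ∈ V from hcc' s ▸ (c' s).2⟩) with hs | hs
  · obtain ⟨d, hd⟩ := exists_incl_comp _ hs
    have h1 : c = (ContinuousMap.inclusion (left_subset_U hUV)).comp d :=
      incl_comp_injective hd.symm
    have h2 : c' = (ContinuousMap.inclusion (left_subset_V hUV)).comp d :=
      incl_comp_injective (hcc.symm.trans hd.symm)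
    subst h1 h2
    exact h d
  -- Over `B` the two lifts to the glued space are the same curve.
  · congr 1
    exact ContinuousMap.ext fun s => inU_eq_inV_iff.2 ⟨hcc' s, hs s⟩

/-- Compatibility of the transports on the glued space and on `X`. -/
theorem map_basedTransport_glue {Y Z : Type*} [TopologicalSpace Y] [TopologicalSpace Z] {z₀ : Z}
    (f : C(Z, Y)) (j : PiOne Z z₀ →* H) (Φ : H →* PiOne Y (f z₀))
    (hΦ : ∀ g, Φ (j g) = PiOne.map f rfl g) (C : ∀ z, Path.Homotopic.Quotient z₀ z) (u : Z → H)
    (E : ∀ y, Path.Homotopic.Quotient (f z₀) y)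
    (hE : ∀ z, ∃ w, PiOne.ofClass w = Φ (u z) ∧ (C z).map f = w.trans (E (f z))) (c : C(I, Z)) :
    Φ (basedTransport j C u c) = basedTransport (MonoidHom.id _) E 1 (f.comp c) := by
  -- Substituting `C z = w · E (f z)` after applying `f`, the loops `w` and `w'` at the two ends
  -- cancel against the images of the gauge.
  obtain ⟨w, hw, hC⟩ := hE (c 0)
  obtain ⟨w', hw', hC'⟩ := hE (c 1)
  simp only [basedTransport, map_mul, map_inv, hΦ, PiOne.map_ofClass, map_trans, map_symm, hC, hC',
    symm_trans_rev, ← hw, ← hw', Pi.one_apply, inv_one, one_mul, mul_one, MonoidHom.id_apply]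
  rw [← PiOne.ofClass_symm, ← PiOne.ofClass_trans, ← PiOne.ofClass_trans]
  congr 1
  simp only [Path.Homotopic.Quotient.trans_assoc, Path.Homotopic.Quotient.symm_trans,
    Path.Homotopic.Quotient.trans_refl]
  rw [← Path.Homotopic.Quotient.trans_assoc w.symm, Path.Homotopic.Quotient.symm_trans,
    Path.Homotopic.Quotient.refl_trans]
  rfl

theorem tau_eq_ofClass (hUV : U ∩ V = A ∪ B) (ha : a ∈ A) (hb : b ∈ B)
    (p : Path (⟨b, right_subset_U hUV hb⟩ : U) ⟨a, left_subset_U hUV ha⟩)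
    (q : Path (⟨b, right_subset_V hUV hb⟩ : V) ⟨a, left_subset_V hUV ha⟩) :
    tau hUV ha hb p q = PiOne.ofClass (Path.Homotopic.Quotient.trans (x₀ := b) (x₁ := a) (x₂ := b)
      ((Path.Homotopic.Quotient.mk (pathU hUV ha hb p)).map (sigma U V B))
      ((Path.Homotopic.Quotient.mk (pathV hUV ha hb q)).map (sigma U V B)).symm) :=
  rfl

/-- With `P`, `Q`, `R` the images in `X` of `p'`, `q` and a loop in `A`, this is `P R P⁻¹ = (P
Q⁻¹)(Q R Q⁻¹)(P Q⁻¹)⁻¹`; the same `R` occurs for both copies of `A`. -/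
theorem sigma_thetaHat (hUV : U ∩ V = A ∪ B) (ha : a ∈ A) (hb : b ∈ B)
    (p : Path (⟨b, right_subset_U hUV hb⟩ : U) ⟨a, left_subset_U hUV ha⟩)
    (q : Path (⟨b, right_subset_V hUV hb⟩ : V) ⟨a, left_subset_V hUV ha⟩)
    (α : PiOne A ⟨a, ha⟩) :
    PiOne.map (sigma U V B) (y := b) rfl (thetaHat hUV ha hb p α) = tau hUV ha hb p q *
      PiOne.map (sigma U V B) (y := b) rfl (theta hUV ha hb q α) * (tau hUV ha hb p q)⁻¹ := by
  obtain ⟨g, rfl⟩ := PiOne.exists_ofClass α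
  let P : Path.Homotopic.Quotient b a :=
    (Path.Homotopic.Quotient.mk (pathU hUV ha hb p)).map (sigma U V B)
  let Q : Path.Homotopic.Quotient b a :=
    (Path.Homotopic.Quotient.mk (pathV hUV ha hb q)).map (sigma U V B)
  let R : Path.Homotopic.Quotient a a := g.map (incl A)
  have h1 : PiOne.map (sigma U V B) (y := b) rfl (thetaHat hUV ha hb p (PiOne.ofClass g)) =
      PiOne.ofClass (P.trans (R.trans P.symm)) := by
    change PiOne.map (sigma U V B) (y := b) rfl (PiOne.changeBase (pathU hUV ha hb p)
      (PiOne.map (viaU hUV) rfl (PiOne.ofClass g))) = _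
    rw [PiOne.map_ofClass, PiOne.changeBase_ofClass]
    refine (PiOne.map_ofClass (sigma U V B) _).trans ?_
    rw [map_trans, map_trans, map_symm, ← Path.Homotopic.Quotient.map_comp]
    rfl
  have h2 : PiOne.map (sigma U V B) (y := b) rfl (theta hUV ha hb q (PiOne.ofClass g)) =
      PiOne.ofClass (Q.trans (R.trans Q.symm)) := by
    change PiOne.map (sigma U V B) (y := b) rfl (PiOne.changeBase (pathV hUV ha hb q)
      (PiOne.map (viaV hUV) rfl (PiOne.ofClass g))) = _
    rw [PiOne.map_ofClass, PiOne.changeBase_ofClass]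
    refine (PiOne.map_ofClass (sigma U V B) _).trans ?_
    rw [map_trans, map_trans, map_symm, ← Path.Homotopic.Quotient.map_comp]
    rfl
  have h3 : tau hUV ha hb p q = PiOne.ofClass (P.trans Q.symm) := tau_eq_ofClass hUV ha hb p q
  rw [h1, h2, h3, ← PiOne.ofClass_symm, ← PiOne.ofClass_trans, ← PiOne.ofClass_trans,
    symm_trans_rev]
  congr 1
  have hc : ∀ {x : X} (S : Path.Homotopic.Quotient a x), Q.symm.trans (Q.trans S) = S := by
    intro x S
    rw [← Path.Homotopic.Quotient.trans_assoc, Path.Homotopic.Quotient.symm_trans,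
      Path.Homotopic.Quotient.refl_trans]
  simp only [Path.Homotopic.Quotient.trans_assoc, hc]
  have hc' : Q.symm.trans (Q.symm.symm.trans P.symm) = P.symm := by
    rw [← Path.Homotopic.Quotient.trans_assoc, Path.Homotopic.Quotient.trans_symm,
      Path.Homotopic.Quotient.refl_trans]
  rw [hc']

/-- The homomorphism to `π₁(X, b)` that is `σ_*` on `π₁(C, b)` and maps `t` to `τ`. -/
noncomputable def toPiOne (hUV : U ∩ V = A ∪ B) (ha : a ∈ A) (hb : b ∈ B)
    (p : Path (⟨b, right_subset_U hUV hb⟩ : U) ⟨a, left_subset_U hUV ha⟩)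
    (q : Path (⟨b, right_subset_V hUV hb⟩ : V) ⟨a, left_subset_V hUV ha⟩) :
    FreeProductWithRelation (theta hUV ha hb q) (thetaHat hUV ha hb p) →* PiOne X b :=
  QuotientGroup.lift _ (Monoid.Coprod.lift (PiOne.map (sigma U V B) (y := b) rfl)
    (FreeGroup.lift fun _ => tau hUV ha hb p q)) (by
      refine Subgroup.normalClosure_le_normal ?_
      rintro _ ⟨α, rfl⟩
      refine MonoidHom.mem_ker.2 ?_
      simp only [map_mul, map_inv, Monoid.Coprod.lift_apply_inl, Monoid.Coprod.lift_apply_inr, t,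
        FreeGroup.lift_apply_of]
      rw [sigma_thetaHat hUV ha hb p q α, mul_inv_cancel])

theorem toPiOne_inl (hUV : U ∩ V = A ∪ B) (ha : a ∈ A) (hb : b ∈ B)
    (p : Path (⟨b, right_subset_U hUV hb⟩ : U) ⟨a, left_subset_U hUV ha⟩)
    (q : Path (⟨b, right_subset_V hUV hb⟩ : V) ⟨a, left_subset_V hUV ha⟩)
    (γ : PiOne (Glue U V B) (inV U V B ⟨b, right_subset_V hUV hb⟩)) :
    toPiOne hUV ha hb p q (QuotientGroup.mk (Monoid.Coprod.inl γ)) =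
      PiOne.map (sigma U V B) (y := b) rfl γ :=
  (QuotientGroup.lift_mk' _ _ _).trans (Monoid.Coprod.lift_apply_inl _ _ γ)

theorem toPiOne_t (hUV : U ∩ V = A ∪ B) (ha : a ∈ A) (hb : b ∈ B)
    (p : Path (⟨b, right_subset_U hUV hb⟩ : U) ⟨a, left_subset_U hUV ha⟩)
    (q : Path (⟨b, right_subset_V hUV hb⟩ : V) ⟨a, left_subset_V hUV ha⟩) :
    toPiOne hUV ha hb p q (QuotientGroup.mk (Monoid.Coprod.inr t)) = tau hUV ha hb p q :=
  (QuotientGroup.lift_mk' _ _ _).trans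
    ((Monoid.Coprod.lift_apply_inr _ _ t).trans FreeGroup.lift_apply_of)

end HNN

/-! ### The inverse homomorphism -/

variable {U V A B : Set X} {a b : X}

/-- The values of a based transport on the glued space along the two copies of a curve in `A`
are images of one element of `π₁(A, a)`, up to the gauge. -/
theorem basedTransport_viaU_eq_viaV (hUV : U ∩ V = A ∪ B) (ha : a ∈ A) (hb : b ∈ B)
    (p : Path (⟨b, right_subset_U hUV hb⟩ : U) ⟨a, left_subset_U hUV ha⟩)
    (q : Path (⟨b, right_subset_V hUV hb⟩ : V) ⟨a, left_subset_V hUV ha⟩)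
    (j : PiOne (Glue U V B) (basePt U hUV hb) →* H) (T : H)
    (hj : ∀ α, j (thetaHat hUV ha hb p α) = T * j (theta hUV ha hb q α) * T⁻¹)
    (d : ∀ x : A, Path.Homotopic.Quotient ⟨a, ha⟩ x)
    (C : ∀ z, Path.Homotopic.Quotient (basePt U hUV hb) z) (u : Glue U V B → H)
    (hCV : ∀ x, C (viaV hUV x) =
      (Path.Homotopic.Quotient.mk (pathV hUV ha hb q)).trans ((d x).map (viaV hUV)))
    (hCU : ∀ x, C (viaU hUV x) =
      (Path.Homotopic.Quotient.mk (pathU hUV ha hb p)).trans ((d x).map (viaU hUV)))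
    (huV : ∀ x, u (viaV hUV x) = 1) (huU : ∀ x, u (viaU hUV x) = T) (c : C(I, A)) :
    basedTransport j C u ((viaU hUV).comp c) = basedTransport j C u ((viaV hUV).comp c) := by
  -- The common element is `α`, the class of `d (c 0) · c · d (c 1)⁻¹`. The two values are `T⁻¹ * j
  -- (θ̂ α) * T` and `j (θ α)`.
  have hα := hj (PiOne.ofClass ((d (c 0)).trans ((arrow c).trans (d (c 1)).symm)))
  have h1 := PiOne.changeBase_map_ofClass (viaU hUV) (pathU hUV ha hb p) (d (c 0)) (d (c 1))
    (arrow c)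
  have h2 := PiOne.changeBase_map_ofClass (viaV hUV) (pathV hUV ha hb q) (d (c 0)) (d (c 1))
    (arrow c)
  rw [← hCU, ← hCU] at h1
  rw [← hCV, ← hCV] at h2
  simp only [basedTransport, ContinuousMap.comp_apply, huU, huV, arrow_comp]
  change T⁻¹ * j (PiOne.ofClass _) * T = 1⁻¹ * j (PiOne.ofClass _) * 1
  erw [← h1, ← h2]
  refine (congrArg (fun g => T⁻¹ * g * T) hα).trans ?_
  simp only [inv_one, one_mul, mul_one]
  group
  rfl

/-- The transport on the glued space with values in the amalgam, and its descent to `X`. -/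
theorem exists_inverse
    (hU : IsOpen U) (hV : IsOpen V) (hX : U ∪ V = Set.univ)
    (hUc : IsPathConnected U) (hVc : IsPathConnected V)
    (hUV : U ∩ V = A ∪ B) (hAB : Disjoint A B) (ha : a ∈ A) (hb : b ∈ B)
    (hA : A = pathComponentIn (U ∩ V) a) (hB : B = pathComponentIn (U ∩ V) b)
    (hBo : IsOpen B)
    (p : Path (⟨b, right_subset_U hUV hb⟩ : U) ⟨a, left_subset_U hUV ha⟩)
    (q : Path (⟨b, right_subset_V hUV hb⟩ : V) ⟨a, left_subset_V hUV ha⟩) :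
    ∃ Ψ : PiOne X b →* FreeProductWithRelation (theta hUV ha hb q) (thetaHat hUV ha hb p),
      (∀ γ, Ψ (PiOne.map (sigma U V B) (y := b) rfl γ) =
        QuotientGroup.mk (Monoid.Coprod.inl γ)) ∧
      Ψ (tau hUV ha hb p q) = QuotientGroup.mk (Monoid.Coprod.inr t) ∧
      ∀ g, toPiOne hUV ha hb p q (Ψ g) = g := by
  let Φ := toPiOne hUV ha hb p q
  let j : PiOne (Glue U V B) (basePt U hUV hb) →*
      FreeProductWithRelation (theta hUV ha hb q) (thetaHat hUV ha hb p) :=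
    (QuotientGroup.mk' _).comp Monoid.Coprod.inl
  let T : FreeProductWithRelation (theta hUV ha hb q) (thetaHat hUV ha hb p) :=
    QuotientGroup.mk (Monoid.Coprod.inr t)
  have hAc : PathConnectedSpace A := isPathConnected_iff_pathConnectedSpace.1
    (hA ▸ isPathConnected_pathComponentIn (hUV.symm.subset (Or.inl ha)))
  have hne (x : A) : Nonempty (Path.Homotopic.Quotient (⟨a, ha⟩ : A) x) :=
    (PathConnectedSpace.joined _ x).elim fun γ => ⟨.mk γ⟩
  obtain ⟨d, hd⟩ := exists_section_extension
    (Q := fun x => Path.Homotopic.Quotient (⟨a, ha⟩ : A) x) (e := fun _ : Unit => ⟨a, ha⟩)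
    (Function.injective_of_subsingleton _) fun _ => .refl _
  -- With the trivial class at `a`, the chosen classes to the two copies of `a` are those of `q` and
  -- `p'` themselves.
  replace hd : d ⟨a, ha⟩ = .refl _ := hd ()
  obtain ⟨C, hCb, hCV, hCU⟩ := exists_framing hUV hAB hb hUc hVc
    (fun x => (Path.Homotopic.Quotient.mk (pathV hUV ha hb q)).trans ((d x).map (viaV hUV)))
    (fun x => (Path.Homotopic.Quotient.mk (pathU hUV ha hb p)).trans ((d x).map (viaU hUV)))
  obtain ⟨u, huA, huV, huU⟩ := exists_gauge hUV hAB T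
  have hψ := isTransport_basedTransport j C u
  obtain ⟨χ, hχ, hχU, hχV⟩ := exists_transport_of_glue hU hV hX hUV hA hB hψ
    (basedTransport_viaU_eq_viaV hUV ha hb p q j T
      (mk_inl_eq_conj (theta hUV ha hb q) (thetaHat hUV ha hb p)) d C u hCV hCU
      (fun x => huV _) huA)
  have hub : u (basePt U hUV hb) = 1 := huV _
  refine ⟨hχ.toHom b, fun γ => ?_, ?_, fun g => ?_⟩
  · obtain ⟨δ, rfl⟩ := PiOne.exists_ofLoop γ
    -- The pullback of `χ` along `σ` and the transport on `C` agree on curves in `U'` and in `V`,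
    -- hence on all curves.
    have h1 : χ ((sigma U V B).comp δ.toContinuousMap) = basedTransport j C u δ.toContinuousMap :=
      transport_glue_ext hBo (right_subset_U hUV) (right_subset_V hUV)
        (hχ.comap (sigma U V B)) hψ hχU hχV δ.toContinuousMap
    have h2 : basedTransport j C u δ.toContinuousMap = j (PiOne.ofLoop δ) := by
      refine (basedTransport_path (y := basePt U hUV hb) (z := basePt U hUV hb) j C u δ).trans ?_
      rw [hub, hCb]
      have : Path.Homotopic.Quotient.symm (.refl (basePt U hUV hb)) = .refl _ :=
        congrArg Path.Homotopic.Quotient.mk Path.refl_symm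
      rw [this, Path.Homotopic.Quotient.trans_refl, Path.Homotopic.Quotient.refl_trans, inv_one,
        one_mul, mul_one]
      rfl
    exact (congrArg (hχ.toHom b) (PiOne.map_ofLoop (sigma U V B) rfl δ)).trans (h1.trans h2)
  -- Along `p'` the path class cancels against the chosen class to its endpoint, leaving only the
  -- gauge `T` there; along `q` the gauge is `1`. Hence `p · q⁻¹` has the value `T`.
  · have hp : χ ((incl U).comp p.toContinuousMap) = T := by
      refine (hχU _).trans ((basedTransport_path j C u (pathU hUV ha hb p)).trans ?_)
      rw [hub, huA, hCb, hCU, hd]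
      change 1⁻¹ * j (PiOne.ofClass (Path.Homotopic.Quotient.trans _ (Path.Homotopic.Quotient.trans
        _ (Path.Homotopic.Quotient.trans _ (.refl _)).symm))) * T = T
      rw [Path.Homotopic.Quotient.trans_refl, Path.Homotopic.Quotient.trans_symm,
        Path.Homotopic.Quotient.trans_refl, PiOne.ofClass_refl, map_one, inv_one, one_mul, one_mul]
    have hq : χ ((incl V).comp q.toContinuousMap) = 1 := by
      refine (hχV _).trans ((basedTransport_path j C u (pathV hUV ha hb q)).trans ?_)
      have huVa : u (viaV hUV ⟨a, ha⟩) = 1 := huV _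
      rw [hub, huVa, hCb, hCV, hd]
      change 1⁻¹ * j (PiOne.ofClass (Path.Homotopic.Quotient.trans _ (Path.Homotopic.Quotient.trans
        _ (Path.Homotopic.Quotient.trans _ (.refl _)).symm))) * 1 = 1
      rw [Path.Homotopic.Quotient.trans_refl, Path.Homotopic.Quotient.trans_symm,
        Path.Homotopic.Quotient.trans_refl, PiOne.ofClass_refl, map_one, inv_one, one_mul, one_mul]
    refine (hχ.map_trans (x := b) (y := a) (z := b) (p.map continuous_subtype_val)
      (q.map continuous_subtype_val).symm).trans ?_
    rw [hχ.map_symm]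
    refine (congrArg₂ (fun x y => x * y⁻¹) hp hq).trans ?_
    rw [inv_one, mul_one]
  -- Path classes in `X` are images of those in `C`, taken through `V` where possible and through
  -- `U'` only outside `V`.
  · have hexE (x : X) : ∃ e : Path.Homotopic.Quotient b x,
        (∀ h : x ∈ V, (C (inV U V B ⟨x, h⟩)).map (sigma U V B) = e) ∧
        (x ∉ V → ∀ h : x ∈ U, (C (inU U V B ⟨x, h⟩)).map (sigma U V B) = e) := by
      by_cases hx : x ∈ V
      · exact ⟨(C (inV U V B ⟨x, hx⟩)).map (sigma U V B), fun _ => rfl, fun h => (h hx).elim⟩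
      · have hx' : x ∈ U := (hX.symm.subset (Set.mem_univ x)).resolve_right hx
        exact ⟨(C (inU U V B ⟨x, hx'⟩)).map (sigma U V B), fun h => (hx h).elim, fun _ _ => rfl⟩
    choose E hEV hEU using hexE
    -- Only on the copy `A'` do the two choices differ: there `P · R` and `Q · R` differ by `P ·
    -- Q⁻¹`, whose class `τ` is the image of the gauge `T`. Elsewhere `w` is trivial.
    have hE : ∀ z, ∃ w : Path.Homotopic.Quotient b b, PiOne.ofClass w = Φ (u z) ∧
        (C z).map (sigma U V B) = w.trans (E (sigma U V B z)) := by
      have hVcase (y : V) : ∃ w : Path.Homotopic.Quotient b b,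
          PiOne.ofClass w = Φ (u (inV U V B y)) ∧
          (C (inV U V B y)).map (sigma U V B) = w.trans (E (sigma U V B (inV U V B y))) := by
        refine ⟨.refl b, ?_, ?_⟩
        · rw [huV, map_one, PiOne.ofClass_refl]
        · rw [Path.Homotopic.Quotient.refl_trans]
          exact hEV y y.2
      intro z
      rcases glue_cases z with ⟨x, rfl⟩ | ⟨y, rfl⟩
      · by_cases hxV : (x : X) ∈ V
        · rcases hUV.subset ⟨x.2, hxV⟩ with hx | hx
          · let P : Path.Homotopic.Quotient b a :=
              (Path.Homotopic.Quotient.mk (pathU hUV ha hb p)).map (sigma U V B)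
            let Q : Path.Homotopic.Quotient b a :=
              (Path.Homotopic.Quotient.mk (pathV hUV ha hb q)).map (sigma U V B)
            let R : Path.Homotopic.Quotient a x := (d ⟨x, hx⟩).map (incl A)
            have h1 : (C (inU U V B x)).map (sigma U V B) = P.trans R := by
              refine (congrArg (·.map (sigma U V B)) (hCU ⟨x, hx⟩)).trans ?_
              simp only [map_trans]
              rw [← Path.Homotopic.Quotient.map_comp]
              rfl
            have h2 : E x = Q.trans R := by
              refine (hEV x hxV).symm.trans
                ((congrArg (·.map (sigma U V B)) (hCV ⟨x, hx⟩)).trans ?_)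
              simp only [map_trans]
              rw [← Path.Homotopic.Quotient.map_comp]
              rfl
            refine ⟨P.trans Q.symm, ?_, ?_⟩
            · rw [show u (inU U V B x) = T from huA ⟨x, hx⟩]
              exact (tau_eq_ofClass hUV ha hb p q).symm.trans (toPiOne_t hUV ha hb p q).symm
            · change _ = (P.trans Q.symm).trans (E x)
              rw [h1, h2, Path.Homotopic.Quotient.trans_assoc,
                ← Path.Homotopic.Quotient.trans_assoc Q.symm,
                Path.Homotopic.Quotient.symm_trans, Path.Homotopic.Quotient.refl_trans]
          · rw [show inU U V B x = inV U V B ⟨x, hxV⟩ from inU_eq_inV _ _ hx]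
            exact hVcase _
        · refine ⟨.refl b, ?_, ?_⟩
          · rw [huU x fun hx => hxV (left_subset_V hUV hx), map_one, PiOne.ofClass_refl]
          · rw [Path.Homotopic.Quotient.refl_trans]
            exact hEU x hxV x.2
      · exact hVcase y
    have hglue := map_basedTransport_glue (sigma U V B) j Φ
      (toPiOne_inl hUV ha hb p q) C u E hE
    -- Two transports on `X` with values in `π₁(X, b)` are compared on curves in `U` and in `V`. On
    -- a loop at `b` the right-hand side is the class of the loop, as `E b` is trivial.
    have hall : ∀ c : C(I, X), Φ (χ c) = basedTransport (MonoidHom.id (PiOne X b)) E 1 c := by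
      refine (hχ.map Φ).eq_of_small (isTransport_basedTransport _ E 1) (𝒲 := {U, V})
        (by rintro W (rfl | rfl) <;> assumption) (by rw [Set.sUnion_pair, hX]) ?_
      rintro c ⟨W, rfl | rfl, hc⟩
      · obtain ⟨c, rfl⟩ := exists_incl_comp c hc
        exact (congrArg Φ (hχU c)).trans (hglue ((inU _ V B).comp c))
      · obtain ⟨c, rfl⟩ := exists_incl_comp c hc
        exact (congrArg Φ (hχV c)).trans (hglue ((inV U _ B).comp c))
    have hEb : E b = .refl b := by
      refine (hEV b (right_subset_V hUV hb)).symm.trans ?_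
      exact congrArg (·.map (sigma U V B)) hCb
    obtain ⟨δ, rfl⟩ := PiOne.exists_ofLoop g
    refine (hall δ.toContinuousMap).trans ((basedTransport_path _ E 1 δ).trans ?_)
    have : Path.Homotopic.Quotient.symm (.refl b) = .refl b :=
      congrArg Path.Homotopic.Quotient.mk Path.refl_symm
    rw [hEb, this, Path.Homotopic.Quotient.trans_refl, Path.Homotopic.Quotient.refl_trans]
    simp only [Pi.one_apply, inv_one, one_mul, mul_one]
    rfl

end VanKampen

theorem mainTheorem4 {X : Type*} [TopologicalSpace X] {U V A B : Set X} {a b : X}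
    (hU : IsOpen U) (hV : IsOpen V) (hX : U ∪ V = Set.univ)
    (hUc : IsPathConnected U) (hVc : IsPathConnected V)
    (hUV : U ∩ V = A ∪ B) (hAB : Disjoint A B) (ha : a ∈ A) (hb : b ∈ B)
    (hA : A = pathComponentIn (U ∩ V) a) (hB : B = pathComponentIn (U ∩ V) b)
    (hBo : IsOpen B)
    (p : Path (⟨b, VanKampen.right_subset_U hUV hb⟩ : U) ⟨a, VanKampen.left_subset_U hUV ha⟩)
    (q : Path (⟨b, VanKampen.right_subset_V hUV hb⟩ : V) ⟨a, VanKampen.left_subset_V hUV ha⟩) :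
    ∃ e : VanKampen.FreeProductWithRelation
          (VanKampen.theta hUV ha hb q) (VanKampen.thetaHat hUV ha hb p) ≃*
        VanKampen.PiOne X b,
      (∀ γ : VanKampen.PiOne (VanKampen.Glue U V B)
          (VanKampen.inV U V B ⟨b, VanKampen.right_subset_V hUV hb⟩),
        e (QuotientGroup.mk (Monoid.Coprod.inl γ)) =
          VanKampen.PiOne.map (VanKampen.sigma U V B) rfl γ) ∧
      e (QuotientGroup.mk (Monoid.Coprod.inr VanKampen.t)) = VanKampen.tau hUV ha hb p q := by
  obtain ⟨Ψ, h1, h2, h3⟩ :=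
    VanKampen.exists_inverse hU hV hX hUc hVc hUV hAB ha hb hA hB hBo p q
  refine ⟨MonoidHom.toMulEquiv (VanKampen.toPiOne hUV ha hb p q) Ψ ?_ (MonoidHom.ext h3),
    VanKampen.toPiOne_inl hUV ha hb p q, VanKampen.toPiOne_t hUV ha hb p q⟩
  -- `Ψ ∘ Φ` is compared with the identity on `π₁(C, b)` and on `t`, which generate the quotient.
  refine QuotientGroup.monoidHom_ext _ (Monoid.Coprod.hom_ext (MonoidHom.ext fun γ => ?_)
    (FreeGroup.ext_hom _ _ fun _ => ?_))
  · exact (congrArg Ψ (VanKampen.toPiOne_inl hUV ha hb p q γ)).trans (h1 γ)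
  · exact (congrArg Ψ (VanKampen.toPiOne_t hUV ha hb p q)).trans h2
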